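/- Let $q\in\mathbb{C}$ with $|q|<1$. Write $(a;q)_n=\prod_{i=0}^{n-1}(1-aq^i)$ and $(a;q)_\infty=\prod_{i=0}^{\infty}(1-aq^i)$, and for integers $n,k\ge 0$ let ${n\brack k}_q=\frac{(q;q)_n}{(q;q)_k(q;q)_{n-k}}$ if $k\le n$ and ${n\brack k}_q=0$ if $k>n$. Let $r(a,b)$ denote the remainder of $a$ on division by $b$. For $t\in\{1,2\}$ and integers $m,n_1,y\ge 0$ put \[Q_t(m,n_1,y)=\binom{m}{2}+\frac{y(3y+1)}{2}+n_1+3y\,r(m+y+t,2)+6y\,r(n_1,2)\,r(m+y+1+t,2).\] Then, for $t=1$ and for $t=2$, \[\sum_{m,n_1,y\ge 0}\frac{q^{Q_t(m,n_1,y)}}{(q^6;q^6)_y}{3y\brack m}_q{y+\lfloor n_1/2\rfloor\brack y}_{q^6}=\frac{1}{(q^2;q^3)_\infty\,(q;q^6)_\infty},\] where the triple series converges absolutely. -/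

import Mathlib

/-- The finite `q`-Pochhammer symbol `(a; q)_n = (1 - a) (1 - a q) ⋯ (1 - a q ^ (n - 1))`. -/
noncomputable def qPoch (a q : ℂ) (n : ℕ) : ℂ :=
  ∏ i ∈ Finset.range n, (1 - a * q ^ i)

/-- The infinite `q`-Pochhammer symbol `(a; q)_∞ = (1 - a) (1 - a q) (1 - a q ^ 2) ⋯`
for `‖q‖ < 1`. -/
noncomputable def qPochInf (a q : ℂ) : ℂ :=
  ∏' i : ℕ, (1 - a * q ^ i)

/-- For `‖q‖ < 1` the infinite product defining `(a; q)_∞` converges. -/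
theorem multipliable_qPochInf (a : ℂ) {q : ℂ} (hq : ‖q‖ < 1) :
    Multipliable fun i : ℕ => 1 - a * q ^ i := by
  have h : Summable fun i : ℕ => ‖-(a * q ^ i)‖ := by
    simp only [norm_neg, norm_mul, norm_pow]
    exact (summable_geometric_of_lt_one (norm_nonneg q) hq).mul_left _
  simpa [sub_eq_add_neg] using multipliable_one_add_of_summable h

/-- The `q`-binomial coefficient `[n choose k]_q` for `‖q‖ < 1`: it equals
`(q; q)_n / ((q; q)_k (q; q)_(n - k))` for `k ≤ n` and `0` for `k > n`. -/
noncomputable def qBinom (q : ℂ) (n k : ℕ) : ℂ :=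
  if k ≤ n then qPoch q q n / (qPoch q q k * qPoch q q (n - k)) else 0

/-- The exponent `Q_t(m, n₁, y)`. The division in `y * (3 * y + 1) / 2` is exact. -/
def exponentQ (t m n₁ y : ℕ) : ℕ :=
  m.choose 2 + y * (3 * y + 1) / 2 + n₁ + 3 * y * ((m + y + t) % 2)
    + 6 * y * (n₁ % 2) * ((m + y + 1 + t) % 2)

/-! Sum over `n₁`, then `m`, then `y`. For fixed `m` and `y`, the even and odd `n₁` each give a
`q`-binomial series in base `q^6` (`hasSum_floor_half`). With `A = q^(3y)`, `B = q^(3y+1)` the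
result is `1 + AB` or `A + B` over `(q^2; q^6)_(y+1)`, according to the parity of `m + y + t`; both
numerators are `((1+A)(1+B) ± (1-A)(1-B))/2`. The finite `q`-binomial theorem at `x = ±1` then sums
over `m`: the signed part vanishes, hence `t` disappears, and `(-q; q)_(3y+1)` remains
(`sum_parity`).

Splitting exponents mod 3 (`qPoch_trisect`) turns the sum over `y` into a summable `₁φ₁` in base
`q^3` (`hasSum_phiTerm`), and `qPochInf_quotient` rewrites its value. Absolute convergence
(`summable_triple`) justifies the reordering. -/

/-! ### Finite `q`-Pochhammer symbols: recurrences and bounds. -/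

lemma qPoch_zero (a q : ℂ) : qPoch a q 0 = 1 := by simp [qPoch]

lemma qPoch_succ (a q : ℂ) (n : ℕ) : qPoch a q (n + 1) = qPoch a q n * (1 - a * q ^ n) := by
  simp [qPoch, Finset.prod_range_succ]

lemma qPoch_succ' (a q : ℂ) (n : ℕ) : qPoch a q (n + 1) = (1 - a) * qPoch (a * q) q n := by
  simp only [qPoch, Finset.prod_range_succ', pow_zero, mul_one]
  rw [mul_comm]
  congr 1
  exact Finset.prod_congr rfl fun i _ => by ring

lemma qPoch_add (a q : ℂ) (k n : ℕ) :
    qPoch a q (n + k) = qPoch a q k * qPoch (a * q ^ k) q n := by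
  rw [add_comm, qPoch, Finset.prod_range_add]
  simp only [qPoch]
  congr 1
  exact Finset.prod_congr rfl fun i _ => by ring

lemma norm_mul_pow_le {a q : ℂ} {r : ℝ} (ha : ‖a‖ ≤ r) (hq : ‖q‖ ≤ 1) (i : ℕ) :
    ‖a * q ^ i‖ ≤ r := by
  rw [norm_mul, norm_pow]
  exact (mul_le_of_le_one_right (norm_nonneg _) (pow_le_one₀ (norm_nonneg _) hq)).trans ha

lemma one_sub_mul_pow_ne_zero {a q : ℂ} (ha : ‖a‖ < 1) (hq : ‖q‖ ≤ 1) (i : ℕ) :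
    1 - a * q ^ i ≠ 0 := by
  intro h
  have h1 := norm_mul_pow_le le_rfl hq i (a := a)
  rw [← sub_eq_zero.1 h, norm_one] at h1
  linarith

lemma qPoch_ne_zero {a q : ℂ} (ha : ‖a‖ < 1) (hq : ‖q‖ ≤ 1) (n : ℕ) : qPoch a q n ≠ 0 :=
  Finset.prod_ne_zero_iff.2 fun i _ => one_sub_mul_pow_ne_zero ha hq i

lemma norm_qPoch_le {a q : ℂ} (ha : ‖a‖ ≤ 1) (hq : ‖q‖ ≤ 1) (n : ℕ) :
    ‖qPoch a q n‖ ≤ 2 ^ n := by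
  induction n with
  | zero => simp [qPoch]
  | succ n ih =>
    rw [qPoch_succ, pow_succ, norm_mul]
    refine mul_le_mul ih ?_ (norm_nonneg _) (by positivity)
    have h1 := norm_sub_le (1 : ℂ) (a * q ^ n)
    rw [norm_one] at h1
    linarith [norm_mul_pow_le ha hq n]

lemma le_norm_qPoch {a q : ℂ} {r : ℝ} (ha : ‖a‖ ≤ r) (hr : r < 1) (hq : ‖q‖ ≤ 1) (n : ℕ) :
    (1 - r) ^ n ≤ ‖qPoch a q n‖ := by
  induction n with
  | zero => simp [qPoch]
  | succ n ih =>
    rw [qPoch_succ, pow_succ, norm_mul]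
    refine mul_le_mul ih ?_ (by linarith) (norm_nonneg _)
    have h1 := norm_sub_norm_le (1 : ℂ) (a * q ^ n)
    rw [norm_one] at h1
    linarith [norm_mul_pow_le ha hq n]

/-! ### `q`-binomial coefficients and their generating functions. -/

lemma qBinom_zero_right {q : ℂ} (hq : ‖q‖ < 1) (n : ℕ) : qBinom q n 0 = 1 := by
  simp [qBinom, qPoch_zero, qPoch_ne_zero hq hq.le]

lemma qBinom_self {q : ℂ} (hq : ‖q‖ < 1) (n : ℕ) : qBinom q n n = 1 := by
  simp [qBinom, qPoch_zero, qPoch_ne_zero hq hq.le]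

lemma qBinom_of_lt (q : ℂ) {n k : ℕ} (h : n < k) : qBinom q n k = 0 := by
  simp [qBinom, h]

lemma qBinom_succ_succ {q : ℂ} (hq : ‖q‖ < 1) (n k : ℕ) :
    qBinom q (n + 1) (k + 1) = qBinom q n k + q ^ (k + 1) * qBinom q n (k + 1) := by
  rcases lt_trichotomy n k with h | rfl | h
  · simp [qBinom_of_lt, h, h.trans (Nat.lt_succ_self k)]
  · simp [qBinom_self hq, qBinom_of_lt]
  · obtain ⟨d, rfl⟩ := Nat.exists_eq_add_of_lt h
    have e1 : k + d + 1 - k = d + 1 := by omega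
    have e2 : k + d + 1 - (k + 1) = d := by omega
    have e3 : k + d + 1 + 1 - (k + 1) = d + 1 := by omega
    rw [qBinom, qBinom, qBinom, if_pos (by omega), if_pos (by omega), if_pos (by omega), e1, e2, e3,
      qPoch_succ q q (k + d + 1), qPoch_succ q q k, qPoch_succ q q d]
    have h1 := qPoch_ne_zero hq hq.le k
    have h2 := qPoch_ne_zero hq hq.le d
    have h3 := one_sub_mul_pow_ne_zero hq hq.le k
    have h4 := one_sub_mul_pow_ne_zero hq hq.le d
    field_simp
    ring

lemma norm_qBinom_le {q : ℂ} {r : ℝ} (hqr : ‖q‖ ≤ r) (hr : r < 1) (n k : ℕ) :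
    ‖qBinom q n k‖ ≤ (2 / (1 - r)) ^ n := by
  have h0 : 0 < 1 - r := by linarith
  have hq : ‖q‖ ≤ 1 := hqr.trans hr.le
  rcases le_or_gt k n with h | h
  · rw [qBinom, if_pos h, norm_div, norm_mul, div_pow]
    refine div_le_div₀ (by positivity) (norm_qPoch_le hq hq n) (by positivity) ?_
    calc (1 - r) ^ n = (1 - r) ^ k * (1 - r) ^ (n - k) := by rw [← pow_add]; congr 1; omega
      _ ≤ _ := mul_le_mul (le_norm_qPoch hqr hr hq k) (le_norm_qPoch hqr hr hq _)
          (by positivity) (norm_nonneg _)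
  · rw [qBinom_of_lt q h, norm_zero]
    positivity

/-- Cancelling `(q; q)_k` leaves `y` factors above and below, so the bound is uniform in `k`. -/
lemma norm_qBinom_add_le {q : ℂ} {r : ℝ} (hqr : ‖q‖ ≤ r) (hr : r < 1) (y k : ℕ) :
    ‖qBinom q (y + k) y‖ ≤ (2 / (1 - r)) ^ y := by
  have h0 : 0 < 1 - r := by linarith
  have hq : ‖q‖ ≤ 1 := hqr.trans hr.le
  rw [qBinom, if_pos (by omega), Nat.add_sub_cancel_left, qPoch_add, mul_comm (qPoch q q k),
    mul_div_mul_right _ _ (qPoch_ne_zero (hqr.trans_lt hr) hq k), norm_div, div_pow]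
  exact div_le_div₀ (by positivity) (norm_qPoch_le (norm_mul_pow_le hq hq k) hq y) (by positivity)
    (le_norm_qPoch hqr hr hq y)

/-- The finite `q`-binomial theorem. -/
lemma sum_qBinom {q : ℂ} (hq : ‖q‖ < 1) (n : ℕ) (x : ℂ) :
    ∑ m ∈ Finset.range (n + 1), q ^ m.choose 2 * qBinom q n m * x ^ m = qPoch (-x) q n := by
  induction n generalizing x with
  | zero => simp [qPoch_zero, qBinom_zero_right hq]
  | succ n ih =>
    -- Pascal's rule, arranged to give `P_(n+1)(x) = (1 + x) P_n(xq)` for the sums `P_n`.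
    have h1 : ∀ m, q ^ (m + 1).choose 2 * qBinom q (n + 1) (m + 1) * x ^ (m + 1)
        = x * (q ^ m.choose 2 * qBinom q n m * (x * q) ^ m)
          + q ^ (m + 1).choose 2 * qBinom q n (m + 1) * (x * q) ^ (m + 1) := by
      intro m
      rw [qBinom_succ_succ hq, Nat.choose_succ_succ' m 1, Nat.choose_one_right]
      ring
    rw [Finset.sum_range_succ', Finset.sum_congr rfl fun m _ => h1 m, Finset.sum_add_distrib,
      ← Finset.mul_sum, ih, add_assoc]
    have h2 : qBinom q (n + 1) 0 = qBinom q n 0 := by simp [qBinom_zero_right hq]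
    have h3 := Finset.sum_range_succ' (fun m => q ^ m.choose 2 * qBinom q n m * (x * q) ^ m) (n + 1)
    rw [Finset.sum_range_succ, ih, qBinom_of_lt q (Nat.lt_succ_self n)] at h3
    rw [h2, pow_zero, ← pow_zero (x * q), ← h3, qPoch_succ', neg_mul]
    ring

/-- The `q`-binomial series `∑ [y + k, y] z ^ k = 1 / (z; q)_(y + 1)`. -/
lemma hasSum_qBinom {q z : ℂ} (hq : ‖q‖ < 1) (hz : ‖z‖ < 1) (y : ℕ) :
    HasSum (fun k => qBinom q (y + k) y * z ^ k) (1 / qPoch z q (y + 1)) := by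
  have hs : ∀ y, Summable fun k => qBinom q (y + k) y * z ^ k := fun y => by
    refine Summable.of_norm_bounded
      ((summable_geometric_of_lt_one (norm_nonneg z) hz).mul_left ((2 / (1 - ‖q‖)) ^ y)) fun k => ?_
    rw [norm_mul, norm_pow]
    exact mul_le_mul_of_nonneg_right (norm_qBinom_add_le le_rfl hq y k) (by positivity)
  refine (hs y).hasSum_iff.2 ?_
  induction y with
  | zero =>
    simp [qBinom_zero_right hq, qPoch, tsum_geometric_of_norm_lt_one hz]
  | succ y ih =>
    -- Pascal's rule again: the sums satisfy `S_y = (1 - z q^(y+1)) S_(y+1)`.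
    have h1 : ∀ k, qBinom q (y + 1 + (k + 1)) (y + 1) * z ^ (k + 1)
        = qBinom q (y + (k + 1)) y * z ^ (k + 1)
          + q ^ (y + 1) * z * (qBinom q (y + 1 + k) (y + 1) * z ^ k) := fun k => by
      rw [show y + 1 + (k + 1) = (y + 1 + k) + 1 by ring, qBinom_succ_succ hq,
        show y + (k + 1) = y + 1 + k by ring]
      ring
    have h2 := (hs (y + 1)).tsum_eq_zero_add
    have h3 := (hs y).tsum_eq_zero_add
    rw [tsum_congr h1, Summable.tsum_add ((summable_nat_add_iff 1).2 (hs y))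
      ((hs (y + 1)).mul_left _), tsum_mul_left] at h2
    simp only [add_zero, qBinom_self hq] at h2 h3
    rw [qPoch_succ, eq_div_iff (mul_ne_zero (qPoch_ne_zero hz hq.le _)
      (one_sub_mul_pow_ne_zero hz hq.le _))]
    rw [ih, div_eq_iff (qPoch_ne_zero hz hq.le _)] at h3
    linear_combination qPoch z q (y + 1) * h2 - h3

/-! ### The `₁φ₁` summation. -/

open Filter Topology

/-- Quadratic exponents absorb the exponential bounds on the Pochhammer factors. -/
lemma summable_pow_mul_pow_choose_two {r : ℝ} (hr0 : 0 < r) (hr : r < 1) {K : ℝ} (hK : 0 < K) :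
    Summable fun n : ℕ => K ^ n * r ^ n.choose 2 := by
  refine summable_of_ratio_test_tendsto_lt_one (l := 0) one_pos
    (Eventually.of_forall fun n => by positivity) ?_
  have h : ∀ n : ℕ, ‖K ^ (n + 1) * r ^ (n + 1).choose 2‖ / ‖K ^ n * r ^ n.choose 2‖
      = K * r ^ n := fun n => by
    rw [Real.norm_of_nonneg (by positivity), Real.norm_of_nonneg (by positivity),
      Nat.choose_succ_succ' n 1, Nat.choose_one_right]
    field_simp
    ring
  simp only [h]
  simpa using (tendsto_pow_atTop_nhds_zero_of_lt_one hr0.le hr).const_mul K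

/-- The terms of the `₁φ₁` series with parameters `a; a * b` and argument `b`. -/
noncomputable def phiTerm (q a b : ℂ) (n : ℕ) : ℂ :=
  qPoch a q n * (-b) ^ n * q ^ n.choose 2 / (qPoch q q n * qPoch (a * b) q n)

lemma norm_phiTerm_le {q a b : ℂ} {r : ℝ} (hq : ‖q‖ ≤ r) (hr : r < 1) (ha : ‖a‖ ≤ 1)
    (hb : ‖b‖ ≤ r) (n : ℕ) :
    ‖phiTerm q a b n‖ ≤ (2 / (1 - r) ^ 2) ^ n * r ^ n.choose 2 := by
  have h0 : 0 < 1 - r := by linarith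
  have hr0 : 0 ≤ r := (norm_nonneg q).trans hq
  have hq1 : ‖q‖ ≤ 1 := hq.trans hr.le
  have hab : ‖a * b‖ ≤ r := by
    rw [norm_mul]
    exact (mul_le_of_le_one_left (norm_nonneg _) ha).trans hb
  rw [phiTerm, norm_div, norm_mul, norm_mul, norm_mul, norm_pow, norm_pow, norm_neg, div_pow,
    div_mul_eq_mul_div]
  refine div_le_div₀ (by positivity) ?_ (by positivity) ?_
  · refine mul_le_mul ?_ (pow_le_pow_left₀ (norm_nonneg _) hq _) (by positivity) (by positivity)
    exact (mul_le_of_le_one_right (norm_nonneg _)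
      (pow_le_one₀ (norm_nonneg _) (hb.trans hr.le))).trans (norm_qPoch_le ha hq1 n)
  · rw [pow_right_comm, sq]
    exact mul_le_mul (le_norm_qPoch hq hr hq1 n) (le_norm_qPoch hab hr hq1 n) (by positivity)
      (norm_nonneg _)

lemma summable_phiTerm {q a b : ℂ} (hq : ‖q‖ < 1) (ha : ‖a‖ ≤ 1) (hb : ‖b‖ < 1) :
    Summable (phiTerm q a b) := by
  obtain ⟨r, hr, hr1⟩ := exists_between (max_lt hq hb)
  have hr0 : 0 < r := (norm_nonneg q).trans_lt ((le_max_left _ _).trans_lt hr)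
  have h0 : 0 < 1 - r := by linarith
  exact Summable.of_norm_bounded (summable_pow_mul_pow_choose_two hr0 hr1 (by positivity))
    (norm_phiTerm_le ((le_max_left _ _).trans hr.le) hr1 ha ((le_max_right _ _).trans hr.le))

lemma norm_mul_lt_one {a b : ℂ} (ha : ‖a‖ ≤ 1) (hb : ‖b‖ < 1) : ‖a * b‖ < 1 := by
  rw [norm_mul]
  exact (mul_le_of_le_one_left (norm_nonneg _) ha).trans_lt hb

/-- Telescoping form of a contiguous relation; the boundary term tends to `0`, leaving `(1 - ab)
F(b) = (1 - b) F(bq)`, to be iterated. -/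
lemma sum_phiTerm_sub {q a b : ℂ} (hq : ‖q‖ < 1) (ha : ‖a‖ ≤ 1) (hb : ‖b‖ < 1) (N : ℕ) :
    ∑ n ∈ Finset.range N, ((1 - a * b) * phiTerm q a b n - (1 - b) * phiTerm q a (b * q) n)
      = - ((1 - a * b) * (1 - q ^ N) * phiTerm q a b N) := by
  have hab := norm_mul_lt_one ha hb
  induction N with
  | zero => simp
  | succ n ih =>
    have h1 := qPoch_succ' (a * b) q n
    rw [qPoch_succ] at h1
    have h2 := one_sub_mul_pow_ne_zero hab hq.le n
    have h3 := qPoch_ne_zero hab hq.le n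
    have h4 := qPoch_ne_zero hq hq.le n
    have h5 := one_sub_mul_pow_ne_zero hq hq.le n
    have h6 : 1 - a * b ≠ 0 := by simpa using one_sub_mul_pow_ne_zero hab hq.le 0
    have h7 : qPoch (a * (b * q)) q n = qPoch (a * b) q n * (1 - a * b * q ^ n) / (1 - a * b) := by
      rw [h1, mul_assoc]
      field_simp
    rw [Finset.sum_range_succ, ih, phiTerm, phiTerm, phiTerm, h7, qPoch_succ, qPoch_succ,
      qPoch_succ, Nat.choose_succ_succ' n 1, Nat.choose_one_right, neg_mul_eq_neg_mul b,
      mul_pow (-b), pow_succ (-b) n, pow_succ q n, pow_add q n]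
    have h5' : 1 - q ^ n * q ≠ 0 := by rwa [mul_comm]
    rw [mul_comm q (q ^ n)]
    field_simp
    ring

lemma tsum_phiTerm_mul {q a b : ℂ} (hq : ‖q‖ < 1) (ha : ‖a‖ ≤ 1) (hb : ‖b‖ < 1) :
    (1 - a * b) * ∑' n, phiTerm q a b n = (1 - b) * ∑' n, phiTerm q a (b * q) n := by
  have hbq : ‖b * q‖ < 1 := by rw [mul_comm]; exact norm_mul_lt_one hq.le hb
  have h1 := summable_phiTerm hq ha hb
  have h2 := summable_phiTerm hq ha hbq
  have h3 := ((h1.mul_left (1 - a * b)).sub (h2.mul_left (1 - b))).hasSum.tendsto_sum_nat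
  simp only [sum_phiTerm_sub hq ha hb] at h3
  have h4 : Tendsto (fun N => -((1 - a * b) * (1 - q ^ N) * phiTerm q a b N)) atTop
      (𝓝 (-((1 - a * b) * (1 - 0) * 0))) :=
    ((((tendsto_pow_atTop_nhds_zero_of_norm_lt_one hq).const_sub 1).const_mul _).mul
      h1.tendsto_atTop_zero).neg
  have h5 := tendsto_nhds_unique h3 h4
  rw [(h1.mul_left _).tsum_sub (h2.mul_left _), tsum_mul_left, tsum_mul_left] at h5
  linear_combination h5

lemma qPoch_mul_tsum_phiTerm {q a b : ℂ} (hq : ‖q‖ < 1) (ha : ‖a‖ ≤ 1) (hb : ‖b‖ < 1) (N : ℕ) :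
    qPoch (a * b) q N * ∑' n, phiTerm q a b n
      = qPoch b q N * ∑' n, phiTerm q a (b * q ^ N) n := by
  induction N with
  | zero => simp [qPoch_zero]
  | succ N ih =>
    have h := tsum_phiTerm_mul hq ha ((norm_mul_pow_le le_rfl hq.le N).trans_lt hb) (b := b * q ^ N)
    rw [qPoch_succ, qPoch_succ, pow_succ, ← mul_assoc b]
    linear_combination (1 - a * b * q ^ N) * ih + qPoch b q N * h

/-- Dominated convergence: at `b = 0` only the term `n = 0` survives. -/
lemma tendsto_tsum_phiTerm {q a b : ℂ} (hq : ‖q‖ < 1) (ha : ‖a‖ ≤ 1) (hb : ‖b‖ < 1) :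
    Tendsto (fun N : ℕ => ∑' n, phiTerm q a (b * q ^ N) n) atTop (𝓝 1) := by
  obtain ⟨r, hr, hr1⟩ := exists_between (max_lt hq hb)
  have hr0 : 0 < r := (norm_nonneg q).trans_lt ((le_max_left _ _).trans_lt hr)
  have h0 : 0 < 1 - r := by linarith
  have hlim : Tendsto (fun N : ℕ => b * q ^ N) atTop (𝓝 0) := by
    simpa using (tendsto_pow_atTop_nhds_zero_of_norm_lt_one hq).const_mul b
  have hterm : ∀ n, Tendsto (fun N : ℕ => phiTerm q a (b * q ^ N) n) atTop
      (𝓝 (phiTerm q a 0 n)) := fun n => by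
    refine Tendsto.comp (f := fun N : ℕ => b * q ^ N) (g := fun x => phiTerm q a x n) ?_ hlim
    refine ContinuousAt.tendsto (f := fun x => phiTerm q a x n) ?_
    unfold phiTerm
    refine ContinuousAt.div (by fun_prop) ?_
      (mul_ne_zero (qPoch_ne_zero hq hq.le n) (qPoch_ne_zero (by simp) hq.le n))
    unfold qPoch
    fun_prop
  have h := tendsto_tsum_of_dominated_convergence
    (summable_pow_mul_pow_choose_two hr0 hr1 (K := 2 / (1 - r) ^ 2) (by positivity)) hterm
    (Eventually.of_forall fun N n => norm_phiTerm_le ((le_max_left _ _).trans hr.le) hr1 ha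
      (norm_mul_pow_le ((le_max_right _ _).trans hr.le) hq.le N) n)
  rwa [tsum_eq_single 0 fun n hn => by simp [phiTerm, hn],
    show phiTerm q a 0 0 = 1 by simp [phiTerm, qPoch_zero]] at h

lemma tendsto_qPoch (a : ℂ) {q : ℂ} (hq : ‖q‖ < 1) :
    Tendsto (qPoch a q) atTop (𝓝 (qPochInf a q)) :=
  (multipliable_qPochInf a hq).tendsto_prod_tprod_nat

lemma qPochInf_ne_zero {a q : ℂ} (ha : ‖a‖ < 1) (hq : ‖q‖ < 1) : qPochInf a q ≠ 0 := by
  simp only [qPochInf, sub_eq_add_neg]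
  refine tprod_one_add_ne_zero_of_summable (fun i => ?_) ?_
  · simpa [sub_eq_add_neg] using one_sub_mul_pow_ne_zero ha hq.le i
  · simp only [norm_neg, norm_mul, norm_pow]
    exact (summable_geometric_of_lt_one (norm_nonneg q) hq).mul_left _

/-- The summation formula for the `₁φ₁` series. -/
lemma hasSum_phiTerm {q a b : ℂ} (hq : ‖q‖ < 1) (ha : ‖a‖ ≤ 1) (hb : ‖b‖ < 1) :
    HasSum (phiTerm q a b) (qPochInf b q / qPochInf (a * b) q) := by
  refine (summable_phiTerm hq ha hb).hasSum_iff.2 ?_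
  rw [eq_div_iff (qPochInf_ne_zero (norm_mul_lt_one ha hb) hq), mul_comm]
  have h1 := (tendsto_qPoch (a * b) hq).mul_const (∑' n, phiTerm q a b n)
  simp only [qPoch_mul_tsum_phiTerm hq ha hb] at h1
  simpa using tendsto_nhds_unique h1
    ((tendsto_qPoch b hq).mul (tendsto_tsum_phiTerm hq ha hb))

/-! ### Infinite product identities. -/

lemma qPochInf_succ (a : ℂ) {q : ℂ} (hq : ‖q‖ < 1) :
    qPochInf a q = (1 - a) * qPochInf (a * q) q := by
  refine tendsto_nhds_unique ((tendsto_add_atTop_iff_nat 1).2 (tendsto_qPoch a hq)) ?_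
  simp only [qPoch_succ']
  exact (tendsto_qPoch _ hq).const_mul _

lemma qPochInf_neg_mul (a : ℂ) {q : ℂ} (hq : ‖q‖ < 1) :
    qPochInf (-a) q * qPochInf a q = qPochInf (a ^ 2) (q ^ 2) := by
  rw [qPochInf, qPochInf, qPochInf, ← (multipliable_qPochInf _ hq).tprod_mul
    (multipliable_qPochInf _ hq)]
  exact tprod_congr fun i => by ring

lemma qPochInf_mul_shift (a : ℂ) {q : ℂ} (hq : ‖q‖ < 1) :
    qPochInf a (q ^ 2) * qPochInf (a * q) (q ^ 2) = qPochInf a q := by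
  have hq2 : ‖q ^ 2‖ < 1 := by
    rw [norm_pow]
    exact pow_lt_one₀ (norm_nonneg _) hq two_ne_zero
  have e1 : ∀ k : ℕ, 1 - a * q ^ (2 * k) = 1 - a * (q ^ 2) ^ k := fun k => by ring
  have e2 : ∀ k : ℕ, 1 - a * q ^ (2 * k + 1) = 1 - a * q * (q ^ 2) ^ k := fun k => by ring
  have h := tprod_even_mul_odd (f := fun i => 1 - a * q ^ i)
    (by simpa only [e1] using multipliable_qPochInf a hq2)
    (by simpa only [e2] using multipliable_qPochInf (a * q) hq2)
  simpa only [e1, e2, qPochInf] using h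

/-- Multiply above and below by `(q^2; q^3)_∞`: the numerator becomes `(q^4; q^6)_∞`, which cancels
against `(q; q^3)_∞ = (q; q^6)_∞ (q^4; q^6)_∞`. -/
lemma qPochInf_quotient {q : ℂ} (hq : ‖q‖ < 1) :
    qPochInf (-q ^ 2) (q ^ 3) / qPochInf q (q ^ 3)
      = 1 / (qPochInf (q ^ 2) (q ^ 3) * qPochInf q (q ^ 6)) := by
  have hp : ∀ k, k ≠ 0 → ‖q ^ k‖ < 1 := fun k hk => by
    rw [norm_pow]
    exact pow_lt_one₀ (norm_nonneg _) hq hk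
  have h1 := qPochInf_neg_mul (q ^ 2) (hp 3 (by norm_num))
  have h2 := qPochInf_mul_shift q (hp 3 (by norm_num))
  have n1 := qPochInf_ne_zero hq (hp 3 (by norm_num))
  have n2 := qPochInf_ne_zero (hp 2 (by norm_num)) (hp 3 (by norm_num))
  have n3 := qPochInf_ne_zero hq (hp 6 (by norm_num))
  rw [show (q ^ 2) ^ 2 = q ^ 4 by ring, show (q ^ 3) ^ 2 = q ^ 6 by ring] at h1
  rw [show (q ^ 3) ^ 2 = q ^ 6 by ring, show q * q ^ 3 = q ^ 4 by ring] at h2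
  rw [div_eq_div_iff n1 (mul_ne_zero n2 n3)]
  linear_combination qPochInf q (q ^ 6) * h1 + h2

/-! ### The inner sums over `n₁` and `m`. -/

lemma norm_pow_lt_one {q : ℂ} (hq : ‖q‖ < 1) {k : ℕ} (hk : k ≠ 0) : ‖q ^ k‖ < 1 := by
  rw [norm_pow]
  exact pow_lt_one₀ (norm_nonneg _) hq hk

/-- The contribution of `n₁` to the sum, for fixed `y` and fixed parity `s` of `m + y + t`. -/
lemma hasSum_floor_half {q : ℂ} (hq : ‖q‖ < 1) (y s : ℕ) :
    HasSum (fun n : ℕ => q ^ (n + 3 * y * (s % 2) + 6 * y * (n % 2) * ((s + 1) % 2))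
        * qBinom (q ^ 6) (y + n / 2) y)
      (((1 + q ^ (3 * y)) * (1 + q ^ (3 * y + 1))
        + (-1) ^ s * ((1 - q ^ (3 * y)) * (1 - q ^ (3 * y + 1)))) / 2
        / qPoch (q ^ 2) (q ^ 6) (y + 1)) := by
  have h := hasSum_qBinom (norm_pow_lt_one hq (k := 6) (by norm_num))
    (norm_pow_lt_one hq (k := 2) two_ne_zero) y
  have e1 : ∀ k : ℕ, (2 * k) % 2 = 0 := by omega
  have e2 : ∀ k : ℕ, (2 * k + 1) % 2 = 1 := by omega
  have e3 : ∀ k : ℕ, (2 * k) / 2 = k := by omega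
  have e4 : ∀ k : ℕ, (2 * k + 1) / 2 = k := by omega
  rcases Nat.even_or_odd s with hs | hs
  · have e5 : s % 2 = 0 := Nat.even_iff.1 hs
    have e6 : (s + 1) % 2 = 1 := by omega
    rw [hs.neg_one_pow, e5, e6]
    convert HasSum.even_add_odd (m := 1 / qPoch (q ^ 2) (q ^ 6) (y + 1))
      (m' := q ^ (6 * y + 1) * (1 / qPoch (q ^ 2) (q ^ 6) (y + 1))) ?_ ?_ using 1
    · ring
    · refine h.congr_fun fun k => ?_
      rw [e1, e3]
      ring
    · refine (h.mul_left (q ^ (6 * y + 1))).congr_fun fun k => ?_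
      rw [e2, e4]
      ring
  · have e5 : s % 2 = 1 := Nat.odd_iff.1 hs
    have e6 : (s + 1) % 2 = 0 := by omega
    rw [hs.neg_one_pow, e5, e6]
    convert HasSum.even_add_odd (m := q ^ (3 * y) * (1 / qPoch (q ^ 2) (q ^ 6) (y + 1)))
      (m' := q ^ (3 * y + 1) * (1 / qPoch (q ^ 2) (q ^ 6) (y + 1))) ?_ ?_ using 1
    · ring
    · refine (h.mul_left (q ^ (3 * y))).congr_fun fun k => ?_
      rw [e3]
      ring
    · refine (h.mul_left (q ^ (3 * y + 1))).congr_fun fun k => ?_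
      rw [e4]
      ring

lemma qPoch_neg_one_mul (q : ℂ) (n : ℕ) :
    qPoch (-1) q (n + 1) = 2 * qPoch (-q) q n := by
  rw [qPoch_succ', neg_one_mul]
  ring

/-- The second factor is needed only at `y = 0`, where the Pochhammer symbol is empty. -/
lemma qPoch_one_mul_eq_zero (q : ℂ) (y : ℕ) : qPoch 1 q (3 * y) * (1 - q ^ (3 * y)) = 0 := by
  rw [mul_eq_zero]
  rcases y with _ | y
  · simp
  · left
    rw [show 3 * (y + 1) = 3 * y + 2 + 1 by ring, qPoch_succ']
    simp

/-- The sum over `m`, after that over `n₁`. -/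
lemma sum_parity {q : ℂ} (hq : ‖q‖ < 1) (y t : ℕ) :
    ∑ m ∈ Finset.range (3 * y + 1), q ^ m.choose 2 * qBinom q (3 * y) m
        * (((1 + q ^ (3 * y)) * (1 + q ^ (3 * y + 1))
        + (-1) ^ (m + y + t) * ((1 - q ^ (3 * y)) * (1 - q ^ (3 * y + 1)))) / 2)
      = qPoch (-q) q (3 * y + 1) := by
  have h1 := sum_qBinom hq (3 * y) 1
  have h2 := sum_qBinom hq (3 * y) (-1)
  have h3 : qPoch (-1) q (3 * y) * (1 + q ^ (3 * y)) * (1 + q ^ (3 * y + 1))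
      = 2 * qPoch (-q) q (3 * y + 1) := by
    rw [← qPoch_neg_one_mul, qPoch_succ, qPoch_succ]
    ring
  have h4 := qPoch_one_mul_eq_zero q y
  simp only [one_pow, mul_one, neg_neg] at h1 h2
  calc _ = (∑ m ∈ Finset.range (3 * y + 1), q ^ m.choose 2 * qBinom q (3 * y) m)
          * ((1 + q ^ (3 * y)) * (1 + q ^ (3 * y + 1)) / 2)
        + (∑ m ∈ Finset.range (3 * y + 1), q ^ m.choose 2 * qBinom q (3 * y) m * (-1) ^ m)
          * ((-1) ^ (y + t) * ((1 - q ^ (3 * y)) * (1 - q ^ (3 * y + 1))) / 2) := by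
        rw [Finset.sum_mul, Finset.sum_mul, ← Finset.sum_add_distrib]
        exact Finset.sum_congr rfl fun m _ => by rw [add_assoc m, pow_add (-1) m]; ring
    _ = _ := by
        rw [h1, h2]
        linear_combination h3 / 2 + ((-1) ^ (y + t) * (1 - q ^ (3 * y + 1)) / 2) * h4

/-! ### The outer sum over `y`. -/

/-- Split the exponents `1, …, 3y+1` mod 3 and apply `(a; p)_n (-a; p)_n = (a^2; p^2)_n` to the
classes 0 and 1. -/
lemma qPoch_trisect (q : ℂ) (y : ℕ) :
    qPoch (-q) q (3 * y + 1) * (qPoch (q ^ 3) (q ^ 3) y * qPoch q (q ^ 3) (y + 1))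
      = qPoch (-q ^ 2) (q ^ 3) y * (qPoch (q ^ 6) (q ^ 6) y * qPoch (q ^ 2) (q ^ 6) (y + 1)) := by
  induction y with
  | zero => simp [qPoch]; ring
  | succ y ih =>
    rw [show 3 * (y + 1) + 1 = 3 * y + 1 + 1 + 1 + 1 by ring, qPoch_succ _ _ (3 * y + 1 + 1 + 1),
      qPoch_succ _ _ (3 * y + 1 + 1), qPoch_succ _ _ (3 * y + 1), qPoch_succ (q ^ 3),
      qPoch_succ q (q ^ 3) (y + 1), qPoch_succ (-q ^ 2), qPoch_succ (q ^ 6),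
      qPoch_succ (q ^ 2) (q ^ 6) (y + 1)]
    linear_combination (1 - -q * q ^ (3 * y + 1 + 1 + 1)) * (1 - -q * q ^ (3 * y + 1 + 1))
      * (1 - -q * q ^ (3 * y + 1)) * (1 - q ^ 3 * (q ^ 3) ^ y) * (1 - q * (q ^ 3) ^ (y + 1)) * ih

lemma triangular_exponent (y : ℕ) : y * (3 * y + 1) / 2 = 3 * y.choose 2 + 2 * y := by
  induction y with
  | zero => rfl
  | succ y ih =>
    rw [Nat.choose_succ_succ' y 1, Nat.choose_one_right,
      show (y + 1) * (3 * (y + 1) + 1) = y * (3 * y + 1) + 2 * (3 * y + 2) by ring]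
    simp only [Nat.reduceAdd]
    omega

lemma hasSum_outer {q : ℂ} (hq : ‖q‖ < 1) :
    HasSum (fun y : ℕ => q ^ (y * (3 * y + 1) / 2) * qPoch (-q) q (3 * y + 1)
        / (qPoch (q ^ 6) (q ^ 6) y * qPoch (q ^ 2) (q ^ 6) (y + 1)))
      (1 / (qPochInf (q ^ 2) (q ^ 3) * qPochInf q (q ^ 6))) := by
  have h2 := norm_pow_lt_one hq (k := 2) two_ne_zero
  have h3 := norm_pow_lt_one hq (k := 3) (by norm_num)
  have h6 := norm_pow_lt_one hq (k := 6) (by norm_num)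
  have h2' : ‖-q ^ 2‖ < 1 := by rwa [norm_neg]
  -- Base `q^3` with `a = b = -q^2`, so `ab = q^4`; the factor `1 / (1 - q)` completes `(q^4;
  -- q^3)_y` to `(q; q^3)_(y+1)`.
  have h := (hasSum_phiTerm h3 h2'.le h2').mul_left (1 / (1 - q))
  have e : -q ^ 2 * -q ^ 2 = q * q ^ 3 := by ring
  have hv : 1 / (1 - q) * (qPochInf (-q ^ 2) (q ^ 3) / qPochInf (-q ^ 2 * -q ^ 2) (q ^ 3))
      = 1 / (qPochInf (q ^ 2) (q ^ 3) * qPochInf q (q ^ 6)) := by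
    rw [← qPochInf_quotient hq, qPochInf_succ q h3, e, div_mul_div_comm, one_mul]
  rw [hv] at h
  refine h.congr_fun fun y => ?_
  have n1 := qPoch_ne_zero h6 h6.le y
  have n2 := qPoch_ne_zero h2 h6.le (y + 1)
  have n3 := qPoch_ne_zero h3 h3.le y
  have n4 := qPoch_ne_zero hq h3.le (y + 1)
  rw [phiTerm, e, div_mul_div_comm, mul_left_comm (1 - q), ← qPoch_succ',
    div_eq_div_iff (mul_ne_zero n1 n2) (mul_ne_zero n3 n4), triangular_exponent, neg_neg]
  linear_combination q ^ (3 * y.choose 2 + 2 * y) * qPoch_trisect q y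

/-! ### Absolute convergence and assembly. -/

lemma summable_triple (t : ℕ) {q : ℂ} (hq : ‖q‖ < 1) :
    Summable fun p : ℕ × ℕ × ℕ =>
      q ^ exponentQ t p.1 p.2.1 p.2.2 / qPoch (q ^ 6) (q ^ 6) p.2.2
        * qBinom q (3 * p.2.2) p.1 * qBinom (q ^ 6) (p.2.2 + p.2.1 / 2) p.2.2 := by
  obtain ⟨r, hqr, hr⟩ := exists_between hq
  have hr0 : 0 < r := (norm_nonneg q).trans_lt hqr
  have h0 : 0 < 1 - r := by linarith
  have hq6 : ‖q ^ 6‖ ≤ r := by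
    rw [norm_pow]
    exact (pow_le_of_le_one (norm_nonneg _) hq.le (by norm_num)).trans hqr.le
  have hs1 : Summable fun m : ℕ => r ^ m.choose 2 := by
    simpa using summable_pow_mul_pow_choose_two hr0 hr one_pos
  have hs2 := summable_geometric_of_lt_one hr0.le hr
  set K := 1 / (1 - r) * (2 / (1 - r)) ^ 3 * (2 / (1 - r)) with hK
  have hK0 : 0 < K := by positivity
  have hs3 := summable_pow_mul_pow_choose_two hr0 hr hK0
  refine Summable.of_norm_bounded (hs1.mul_of_nonneg (hs2.mul_of_nonneg hs3
    (fun n => by positivity) fun n => by positivity) (fun n => by positivity)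
    fun n => by positivity) ?_
  rintro ⟨m, n, y⟩
  have hexp : m.choose 2 + n + y.choose 2 ≤ exponentQ t m n y := by
    rw [exponentQ, triangular_exponent]
    omega
  have b1 : ‖q ^ exponentQ t m n y‖ ≤ r ^ (m.choose 2 + n + y.choose 2) := by
    rw [norm_pow]
    exact (pow_le_pow_left₀ (norm_nonneg _) hqr.le _).trans
      (pow_le_pow_of_le_one hr0.le hr.le hexp)
  have b2 := le_norm_qPoch hq6 hr (hq6.trans hr.le) y
  have b3 := norm_qBinom_le hqr.le hr (3 * y) m
  have b4 := norm_qBinom_add_le hq6 hr y (n / 2)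
  simp only [norm_mul, norm_div]
  calc _ ≤ r ^ (m.choose 2 + n + y.choose 2) / (1 - r) ^ y * (2 / (1 - r)) ^ (3 * y)
        * (2 / (1 - r)) ^ y := by gcongr
    _ = _ := by
      rw [hK, mul_pow, mul_pow, ← pow_mul, div_pow 1, one_pow]
      ring

theorem theorem7 (t : ℕ) (ht : t = 1 ∨ t = 2) (q : ℂ) (hq : ‖q‖ < 1) :
    HasSum
      (fun p : ℕ × ℕ × ℕ =>
        let m := p.1
        let n₁ := p.2.1
        let y := p.2.2
        q ^ exponentQ t m n₁ y / qPoch (q ^ 6) (q ^ 6) y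
          * qBinom q (3 * y) m * qBinom (q ^ 6) (y + n₁ / 2) y)
      (1 / (qPochInf (q ^ 2) (q ^ 3) * qPochInf q (q ^ 6))) := by
  set f : ℕ × ℕ × ℕ → ℂ := fun p =>
    q ^ exponentQ t p.1 p.2.1 p.2.2 / qPoch (q ^ 6) (q ^ 6) p.2.2
      * qBinom q (3 * p.2.2) p.1 * qBinom (q ^ 6) (p.2.2 + p.2.1 / 2) p.2.2 with hf
  change HasSum f _
  -- Puts `y` outermost, so that fibrewise summation follows the order `n₁`, `m`, `y`.
  let e : ℕ × ℕ × ℕ ≃ ℕ × ℕ × ℕ :=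
    { toFun := fun p => (p.2.1, p.2.2, p.1)
      invFun := fun p => (p.2.2, p.1, p.2.1)
      left_inv := fun _ => rfl
      right_inv := fun _ => rfl }
  have hsum : Summable (f ∘ e) := e.summable_iff.2 (summable_triple t hq)
  rw [← e.hasSum_iff]
  have hy : ∀ y, HasSum (fun p : ℕ × ℕ => (f ∘ e) (y, p))
      (q ^ (y * (3 * y + 1) / 2) * qPoch (-q) q (3 * y + 1)
        / (qPoch (q ^ 6) (q ^ 6) y * qPoch (q ^ 2) (q ^ 6) (y + 1))) := by
    intro y
    set g : ℕ → ℂ := fun m =>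
      q ^ (y * (3 * y + 1) / 2) / (qPoch (q ^ 6) (q ^ 6) y * qPoch (q ^ 2) (q ^ 6) (y + 1))
        * (q ^ m.choose 2 * qBinom q (3 * y) m * (((1 + q ^ (3 * y)) * (1 + q ^ (3 * y + 1))
        + (-1) ^ (m + y + t) * ((1 - q ^ (3 * y)) * (1 - q ^ (3 * y + 1)))) / 2)) with hg
    have hm : ∀ m, HasSum (fun n => (f ∘ e) (y, m, n)) (g m) := by
      intro m
      have hv : g m = q ^ (m.choose 2 + y * (3 * y + 1) / 2) / qPoch (q ^ 6) (q ^ 6) y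
          * qBinom q (3 * y) m * (((1 + q ^ (3 * y)) * (1 + q ^ (3 * y + 1))
          + (-1) ^ (m + y + t) * ((1 - q ^ (3 * y)) * (1 - q ^ (3 * y + 1)))) / 2
          / qPoch (q ^ 2) (q ^ 6) (y + 1)) := by
        simp only [hg, pow_add q (m.choose 2), div_eq_mul_inv, mul_inv]
        ring
      rw [hv]
      refine ((hasSum_floor_half hq y (m + y + t)).mul_left _).congr_fun fun n => ?_
      simp only [hf, e, Function.comp_apply, Equiv.coe_fn_mk, exponentQ,
        show m + y + 1 + t = m + y + t + 1 by ring]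
      ring
    have h1 := (hsum.comp_injective (Prod.mk_right_injective y)).hasSum
    have h2 := h1.prod_fiberwise hm
    have hg0 : ∀ m ∉ Finset.range (3 * y + 1), g m = 0 := fun m hm => by
      have h : 3 * y < m := by
        rw [Finset.mem_range] at hm
        omega
      simp only [hg, qBinom_of_lt q h, mul_zero, zero_mul]
    have h3 := hasSum_sum_of_ne_finset_zero hg0 (L := .unconditional ℕ)
    simp only [hg] at h3
    rw [← Finset.mul_sum, sum_parity hq, ← hg] at h3
    rwa [h2.unique h3, div_mul_eq_mul_div] at h1
  have h := hsum.hasSum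
  rwa [(h.prod_fiberwise hy).unique (hasSum_outer hq)] at h
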